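/- Let $r,m\ge 1$ be integers. Let $\zeta_r$ denote the multiple zeta function of order $r$, $$\zeta_r(s)=\sum_{n_1,\dots,n_r=0}^{\infty}\frac{1}{(n_1+\cdots+n_r+r)^{s}}\qquad(\operatorname{Re} s>r),$$ continued analytically to $\mathbb C\setminus\{1,\dots,r\}$. For $\lambda\in\mathbb C\setminus(-\infty,0]$, with $\log$ the principal logarithm, let the $\lambda$-Bernoulli polynomials of order $r$ be defined by $$\left(\frac{\log\lambda+t}{\lambda e^{t}-1}\right)^{r}e^{xt}=\sum_{n=0}^{\infty}B^{(r)}_{n}(\lambda;x)\frac{t^{n}}{n!}\qquad(|t|\text{ small}),$$ where the removable singularity of $\frac{\log\lambda+t}{\lambda e^t-1}$ at $t=-\log\lambda$ is filled in by the value $1$. Then the continuation $\zeta_r$ exists, and for every $\lambda\in\mathbb C\setminus(-\infty,0]$ the following series converges absolutely and $$\zeta_r(-m)=(-\lambda)^{r}\,m!\sum_{j=0}^{\infty}\binom{-m-r-1}{j}(\log\lambda)^{j}\,\frac{B^{(r)}_{m+r+j}(\lambda;r)}{(m+r+j)!}.$$ -/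

import Mathlib

/-- The function `t ↦ (log lam + t) / (lam * exp t - 1)` of a complex variable (principal branch of
the logarithm), with its removable singularity at `t = -log lam` filled in by its limit `1`. For
`lam = 1` this is `t / (exp t - 1)`, with value `1` at `t = 0`. -/
noncomputable def lambdaBernoulliGen (lam t : ℂ) : ℂ :=
  if Complex.log lam + t = 0 then 1
  else (Complex.log lam + t) / (lam * Complex.exp t - 1)

/-- The value at `x` of the `n`-th lambda-Bernoulli polynomial of order `r`: the coefficient of
`t ^ n / n!` in the Taylor expansion at `t = 0` of
`((log lam + t) / (lam * exp t - 1)) ^ r * exp (x * t)`. -/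
noncomputable def lambdaBernoulli (r n : ℕ) (lam x : ℂ) : ℂ :=
  iteratedDeriv n (fun t : ℂ => lambdaBernoulliGen lam t ^ r * Complex.exp (x * t)) 0

/-- `Z` is the multiple zeta function of order `r`: it is the sum of the series
`∑ 1 / (n₁ + ⋯ + n_r + r) ^ s` over all `n₁, …, n_r ≥ 0` in the half-plane `Re s > r` in which the
series converges, and it is holomorphic on the complex plane without the points `1, …, r`
(values at these points are arbitrary). -/
structure IsMultipleZeta (r : ℕ) (Z : ℂ → ℂ) : Prop where
  hasSum : ∀ s : ℂ, (r : ℝ) < s.re →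
    HasSum (fun n : Fin r → ℕ => 1 / (((∑ i, n i) + r : ℕ) : ℂ) ^ s) (Z s)
  differentiableOn :
    DifferentiableOn ℂ Z {s : ℂ | ∀ k : ℕ, 1 ≤ k → k ≤ r → s ≠ (k : ℂ)}

/-! Let G(u) = u / (1 - exp(-u)), which is `bernoulliGen`. Both sides reduce to the coefficient of
u^(m+r) in G^r. Zeta side: the recursion ζ_{k+2}(s) = ζ_{k+1}(s-1)/(k+1) - ζ_{k+1}(s) builds the
continuation from the Riemann zeta function. The equation u G' = G + u G - G² gives the coefficients
of the powers of G the same recursion, whence `multipleZetaSucc_neg_nat`. Bernoulli side: at x = r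
the exponential turns the generating function into λ^(-r) G(log λ + t)^r, so the λ-Bernoulli numbers
are derivatives of G^r at log λ. The series is then the Taylor expansion of the (m+r)-th derivative
of G^r about log λ, evaluated at 0. It converges since 0 is closer to log λ than any pole of G. -/

/-! ### Continuation of the multiple zeta function. -/

section MultipleZeta

open Complex Finset

/-- The multiple zeta function of order `k + 1`. -/
noncomputable def multipleZetaSucc : ℕ → ℂ → ℂ
  | 0 => riemannZeta
  | k + 1 => fun s => multipleZetaSucc k (s - 1) / (k + 1) - multipleZetaSucc k s

theorem hasSum_multipleZetaSucc (k : ℕ) (s : ℂ) (hs : (k : ℝ) + 1 < s.re) :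
    HasSum (fun M : ℕ => ((M + k).choose k : ℂ) / ((M + k + 1 : ℕ) : ℂ) ^ s)
      (multipleZetaSucc k s) := by
  induction k generalizing s with
  | zero =>
    have hs' : 1 < s.re := by simpa using hs
    have h1 := zeta_eq_tsum_one_div_nat_add_one_cpow hs'
    have h2 : Summable fun n : ℕ => 1 / (n : ℂ) ^ s := Complex.summable_one_div_nat_cpow.2 hs'
    have h3 := ((summable_nat_add_iff 1).2 h2).hasSum
    simp only [multipleZetaSucc]
    rw [h1]
    simpa using h3
  | succ k ih =>
    push_cast at hs
    have h1 := ih (s - 1) (by simp; linarith)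
    have h2 := ih s (by linarith)
    have h3 := (h1.div_const ((k : ℂ) + 1)).sub h2
    have hk : (k : ℂ) + 1 ≠ 0 := by exact_mod_cast Nat.succ_ne_zero k
    have key : ∀ M : ℕ, ((M + k).choose k : ℂ) / ((M + k + 1 : ℕ) : ℂ) ^ (s - 1) / ((k : ℂ) + 1) -
        ((M + k).choose k : ℂ) / ((M + k + 1 : ℕ) : ℂ) ^ s =
        (M : ℂ) * ((M + k).choose k : ℂ) / ((k : ℂ) + 1) / ((M + k + 1 : ℕ) : ℂ) ^ s := by
      intro M
      have hM : ((M + k + 1 : ℕ) : ℂ) ≠ 0 := Nat.cast_ne_zero.mpr (Nat.succ_ne_zero (M + k))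
      have hp : ((M + k + 1 : ℕ) : ℂ) ^ s ≠ 0 := by
        rw [Ne, cpow_eq_zero_iff]
        exact fun h => hM h.1
      rw [cpow_sub _ _ hM, cpow_one]
      generalize ((M + k + 1 : ℕ) : ℂ) ^ s = p at *
      field_simp
      push_cast
      ring
    simp only [key] at h3
    -- The factor M kills the term M = 0; shifting M then yields the coefficients of the next order.
    rw [← hasSum_nat_add_iff' 1] at h3
    simp only [sum_range_one, Nat.cast_zero, zero_mul, zero_div, sub_zero] at h3
    refine (congrArg (HasSum · _) (funext fun M => ?_)).mp h3
    have h4 := Nat.choose_succ_right_eq (M + 1 + k) k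
    rw [Nat.add_sub_cancel] at h4
    have h5 : (((M + 1 + k).choose (k + 1) : ℕ) : ℂ) * (k + 1) =
        ((M + 1 + k).choose k : ℂ) * (M + 1) := by exact_mod_cast h4
    rw [show M + (k + 1) = M + 1 + k by ring]
    congr 1
    rw [div_eq_iff hk, h5]
    push_cast
    ring

theorem card_antidiagonalTuple_succ (k n : ℕ) :
    (Finset.Nat.antidiagonalTuple (k + 1) n).card = (n + k).choose k := by
  classical
  have h : (piAntidiag (univ : Finset (Fin (k + 1))) n).card =
      ((univ : Finset (Fin (k + 1))).finsuppAntidiag n).card := by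
    rw [finsuppAntidiag, card_map, card_attach]
  rw [← piAntidiag_univ_fin_eq_antidiagonalTuple, h,
    card_finsuppAntidiag_nat_eq_choose, card_univ, Fintype.card_fin]
  rw [show k + 1 + n - 1 = n + k by omega, Nat.choose_symm_add]

/-- Group the tuples by their total N; absolute convergence permits the regrouping. -/
theorem hasSum_fin_multipleZetaSucc (k : ℕ) (s : ℂ) (hs : ((k + 1 : ℕ) : ℝ) < s.re) :
    HasSum (fun n : Fin (k + 1) → ℕ => 1 / (((∑ i, n i) + (k + 1) : ℕ) : ℂ) ^ s)
      (multipleZetaSucc k s) := by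
  push_cast at hs
  have h1 := hasSum_multipleZetaSucc k s hs
  have hfib : ∀ N : ℕ, ∀ x : Finset.Nat.antidiagonalTuple (k + 1) N,
      ∑ i, (x : Fin (k + 1) → ℕ) i = N := fun N x =>
    Finset.Nat.mem_antidiagonalTuple.mp x.2
  have hval : ∀ p : (Σ N, Finset.Nat.antidiagonalTuple (k + 1) N),
      1 / (((∑ i, (Finset.Nat.sigmaAntidiagonalTupleEquivTuple (k + 1) p) i) + (k + 1) : ℕ) : ℂ) ^ s
        = 1 / ((p.1 + k + 1 : ℕ) : ℂ) ^ s := by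
    intro p
    have : ∑ i, (Finset.Nat.sigmaAntidiagonalTupleEquivTuple (k + 1) p) i = p.1 := hfib p.1 p.2
    rw [this, add_assoc]
  rw [← (Finset.Nat.sigmaAntidiagonalTupleEquivTuple (k + 1)).hasSum_iff]
  refine (congrArg (HasSum · _) (funext hval)).mpr ?_
  have hsum : Summable fun p : (Σ N, Finset.Nat.antidiagonalTuple (k + 1) N) =>
      1 / ((p.1 + k + 1 : ℕ) : ℂ) ^ s := by
    rw [← summable_norm_iff]
    refine (summable_sigma_of_nonneg fun _ => norm_nonneg _).2
      ⟨fun N => (hasSum_fintype _).summable, ?_⟩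
    refine h1.summable.norm.congr fun N => ?_
    rw [tsum_fintype]
    simp [card_antidiagonalTuple_succ, div_eq_mul_inv]
  have h2 := hsum.hasSum.sigma (fun N => hasSum_fintype _)
  have h3 : (fun N : ℕ => ∑ _x : Finset.Nat.antidiagonalTuple (k + 1) N,
      1 / ((N + k + 1 : ℕ) : ℂ) ^ s) =
      fun M : ℕ => ((M + k).choose k : ℂ) / ((M + k + 1 : ℕ) : ℂ) ^ s := by
    funext N
    simp [card_antidiagonalTuple_succ, div_eq_mul_inv]
  rw [h3] at h2
  rw [← h2.unique h1]
  exact hsum.hasSum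

theorem differentiableOn_multipleZetaSucc (k : ℕ) :
    DifferentiableOn ℂ (multipleZetaSucc k)
      {s : ℂ | ∀ j : ℕ, 1 ≤ j → j ≤ k + 1 → s ≠ (j : ℂ)} := by
  induction k with
  | zero =>
    intro s hs
    exact (differentiableAt_riemannZeta (by simpa using hs 1 le_rfl le_rfl)).differentiableWithinAt
  | succ k ih =>
    refine DifferentiableOn.sub (DifferentiableOn.div_const ?_ _) (ih.mono ?_)
    · refine ih.comp (f := fun s : ℂ => s - 1) (by fun_prop) ?_
      intro s hs j h1 h2 h3
      refine hs (j + 1) (by omega) (by omega) ?_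
      rw [Nat.cast_succ, ← h3]
      ring
    · intro s hs j h1 h2
      exact hs j h1 (by omega)

theorem isMultipleZeta_multipleZetaSucc (k : ℕ) :
    IsMultipleZeta (k + 1) (multipleZetaSucc k) :=
  ⟨hasSum_fin_multipleZetaSucc k, differentiableOn_multipleZetaSucc k⟩

/-- Identity theorem: the plane minus finitely many points is connected, and both functions equal
the series near r + 1. -/
theorem IsMultipleZeta.apply_neg_eq {r : ℕ} {Z W : ℂ → ℂ} (hZ : IsMultipleZeta r Z)
    (hW : IsMultipleZeta r W) (m : ℕ) : Z (-(m : ℂ)) = W (-(m : ℂ)) := by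
  set S : Set ℂ := (fun j : ℕ => (j : ℂ)) '' Set.Icc 1 r with hS
  have hU : {s : ℂ | ∀ k : ℕ, 1 ≤ k → k ≤ r → s ≠ (k : ℂ)} = Sᶜ := by
    ext s
    simp only [hS, Set.mem_ofPred_eq, Set.mem_compl_iff, Set.mem_image, Set.mem_Icc, not_exists,
      not_and]
    exact ⟨fun h j hj e => h j hj.1 hj.2 e.symm, fun h j h1 h2 e => h j ⟨h1, h2⟩ e.symm⟩
  have hfin : S.Finite := (Set.finite_Icc 1 r).image _
  have hopen : IsOpen Sᶜ := hfin.isClosed.isOpen_compl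
  have hconn : IsPreconnected Sᶜ :=
    (hfin.countable.isConnected_compl_of_one_lt_rank (by simp)).isPreconnected
  have hZa := (hU ▸ hZ.differentiableOn).analyticOnNhd hopen
  have hWa := (hU ▸ hW.differentiableOn).analyticOnNhd hopen
  have hmem : ((r + 1 : ℕ) : ℂ) ∈ Sᶜ := by
    rintro ⟨j, hj, e⟩
    have : j = r + 1 := Nat.cast_injective e
    have := hj.2
    omega
  have hev : Z =ᶠ[nhds ((r + 1 : ℕ) : ℂ)] W := by
    have : {s : ℂ | (r : ℝ) < s.re} ∈ nhds ((r + 1 : ℕ) : ℂ) :=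
      (isOpen_lt continuous_const Complex.continuous_re).mem_nhds (by simp)
    filter_upwards [this] with s hs
    exact (hZ.hasSum s hs).unique (hW.hasSum s hs)
  refine hZa.eqOn_of_preconnected_of_eventuallyEq hWa hconn hmem hev ?_
  rintro ⟨j, hj, e⟩
  have h1 : ((j + m : ℕ) : ℂ) = 0 := by
    push_cast
    rw [show (j : ℂ) = -m from e]
    ring
  have h2 : j + m = 0 := by exact_mod_cast h1
  have := hj.1
  omega

end MultipleZeta

/-! ### Recursion for powers of the Bernoulli series. -/

section BernoulliPowerSeries

open PowerSeries Finset

theorem exp_sub_one_ne_zero : PowerSeries.exp ℂ - 1 ≠ 0 := by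
  intro h
  have := congrArg (coeff 1) h
  simp [coeff_exp, coeff_one] at this

/-- Differentiate B (exp X - 1) = X exp X, then cancel exp X - 1. -/
theorem X_mul_derivative_bernoulli'PowerSeries :
    X * d⁄dX ℂ (bernoulli'PowerSeries ℂ) =
      bernoulli'PowerSeries ℂ + X * bernoulli'PowerSeries ℂ - bernoulli'PowerSeries ℂ ^ 2 := by
  have h := bernoulli'PowerSeries_mul_exp_sub_one ℂ
  have hd := congrArg (d⁄dX ℂ) h
  have he : d⁄dX ℂ (PowerSeries.exp ℂ) = PowerSeries.exp ℂ := by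
    ext n
    simp [coeff_derivative, coeff_exp, Nat.factorial_succ]
    field_simp
  simp only [Derivation.leibniz, smul_eq_mul, map_sub, he, derivative_X, 
    Derivation.map_one_eq_zero, sub_zero] at hd
  refine mul_right_cancel₀ exp_sub_one_ne_zero ?_
  linear_combination X * hd - (1 + X - bernoulli'PowerSeries ℂ) * h

theorem X_mul_derivative_bernoulli'PowerSeries_pow (k : ℕ) :
    X * d⁄dX ℂ (bernoulli'PowerSeries ℂ ^ (k + 1)) =
      ((k + 1 : ℕ) : ℂ) • (bernoulli'PowerSeries ℂ ^ (k + 1) + X * bernoulli'PowerSeries ℂ ^ (k + 1) -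
        bernoulli'PowerSeries ℂ ^ (k + 2)) := by
  rw [Derivation.leibniz_pow]
  have h := X_mul_derivative_bernoulli'PowerSeries
  simp only [smul_eq_mul, nsmul_eq_mul, Nat.add_sub_cancel, Nat.cast_smul_eq_nsmul]
  linear_combination ((k + 1 : ℕ) : PowerSeries ℂ) * bernoulli'PowerSeries ℂ ^ k * h

theorem coeff_bernoulli'PowerSeries_pow_succ (k n : ℕ) :
    ((k : ℂ) + 1) * coeff (n + 1) (bernoulli'PowerSeries ℂ ^ (k + 2)) =
      ((k : ℂ) - n) * coeff (n + 1) (bernoulli'PowerSeries ℂ ^ (k + 1)) +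
        ((k : ℂ) + 1) * coeff n (bernoulli'PowerSeries ℂ ^ (k + 1)) := by
  have h := congrArg (coeff (n + 1)) (X_mul_derivative_bernoulli'PowerSeries_pow k)
  simp only [coeff_succ_X_mul, coeff_derivative, map_smul, map_add, map_sub, smul_eq_mul] at h
  push_cast at h
  linear_combination h

theorem multipleZetaSucc_neg_nat (k m : ℕ) :
    multipleZetaSucc k (-(m : ℂ)) =
      (-1) ^ (k + 1) * (m.factorial : ℂ) *
        coeff (m + k + 1) (bernoulli'PowerSeries ℂ ^ (k + 1)) := by
  induction k generalizing m with
  | zero =>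
    rw [multipleZetaSucc, riemannZeta_neg_nat_eq_bernoulli']
    simp only [bernoulli'PowerSeries, zero_add, pow_one, add_zero, coeff_mk, Nat.factorial_succ]
    have h1 : (m.factorial : ℂ) ≠ 0 := by exact_mod_cast m.factorial_ne_zero
    have h2 : (m : ℂ) + 1 ≠ 0 := by exact_mod_cast m.succ_ne_zero
    simp
    field_simp
  | succ k ih =>
    have hk : (k : ℂ) + 1 ≠ 0 := by exact_mod_cast k.succ_ne_zero
    have h1 := ih (m + 1)
    have h2 := coeff_bernoulli'PowerSeries_pow_succ k (m + k + 1)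
    simp only [multipleZetaSucc]
    rw [show -(m : ℂ) - 1 = -((m + 1 : ℕ) : ℂ) by push_cast; ring, h1, ih m]
    rw [show m + 1 + k + 1 = m + k + 1 + 1 by ring, show m + (k + 1) + 1 = m + k + 1 + 1 by ring]
    rw [Nat.factorial_succ]
    push_cast at h2 ⊢
    rw [sub_eq_iff_eq_add, div_eq_iff hk]
    linear_combination (-1) ^ (k + 1) * (m.factorial : ℂ) * h2

end BernoulliPowerSeries

/-! ### Analytic generating function and its Taylor series. -/

section TaylorPowerSeries

open PowerSeries Finset

/-- The Taylor series at `0`, as a formal power series. -/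
noncomputable def taylorPowerSeries (f : ℂ → ℂ) : PowerSeries ℂ :=
  PowerSeries.mk fun n => iteratedDeriv n f 0 / (n.factorial : ℂ)

theorem taylorPowerSeries_congr {f g : ℂ → ℂ} (h : f =ᶠ[nhds 0] g) :
    taylorPowerSeries f = taylorPowerSeries g := by
  ext n
  simp [taylorPowerSeries, h.iteratedDeriv_eq n]

theorem taylorPowerSeries_mul {f g : ℂ → ℂ} (hf : AnalyticAt ℂ f 0) (hg : AnalyticAt ℂ g 0) :
    taylorPowerSeries (fun z => f z * g z) = taylorPowerSeries f * taylorPowerSeries g := by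
  ext n
  simp only [taylorPowerSeries, coeff_mul, coeff_mk]
  rw [iteratedDeriv_fun_mul hf.contDiffAt hg.contDiffAt,
    Finset.Nat.sum_antidiagonal_eq_sum_range_succ_mk, sum_div]
  refine sum_congr rfl fun i hi => ?_
  have hi' : i ≤ n := Nat.lt_succ_iff.mp (mem_range.mp hi)
  have h := Nat.choose_mul_factorial_mul_factorial hi'
  have h1 : (n.factorial : ℂ) ≠ 0 := by exact_mod_cast n.factorial_ne_zero
  have h2 : (i.factorial : ℂ) ≠ 0 := by exact_mod_cast i.factorial_ne_zero
  have h3 : ((n - i).factorial : ℂ) ≠ 0 := by exact_mod_cast (n - i).factorial_ne_zero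
  have h4 : (n.choose i : ℂ) * i.factorial * (n - i).factorial = n.factorial := by exact_mod_cast h
  field_simp
  linear_combination (iteratedDeriv i f 0 * iteratedDeriv (n - i) g 0) * h4

theorem taylorPowerSeries_const (c : ℂ) : taylorPowerSeries (fun _ => c) = C c := by
  ext n
  rcases n with _ | n <;> simp [taylorPowerSeries, iteratedDeriv_const, coeff_C]

theorem taylorPowerSeries_pow {f : ℂ → ℂ} (hf : AnalyticAt ℂ f 0) (k : ℕ) :
    taylorPowerSeries (fun z => f z ^ k) = taylorPowerSeries f ^ k := by
  induction k with
  | zero => simpa using taylorPowerSeries_const 1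
  | succ k ih =>
    simp only [pow_succ]
    rw [taylorPowerSeries_mul (hf.fun_pow k) hf, ih]

theorem taylorPowerSeries_exp : taylorPowerSeries Complex.exp = PowerSeries.exp ℂ := by
  ext n
  simp [taylorPowerSeries, coeff_exp, iteratedDeriv_eq_iterate]

theorem taylorPowerSeries_id : taylorPowerSeries (fun z => z) = X := by
  ext n
  simp only [taylorPowerSeries, iteratedDeriv_fun_id_zero, coeff_mk, coeff_X]
  split_ifs with h <;> simp [h]

theorem taylorPowerSeries_exp_sub_one :
    taylorPowerSeries (fun z => Complex.exp z - 1) = PowerSeries.exp ℂ - 1 := by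
  rw [← taylorPowerSeries_exp]
  ext n
  rcases n with _ | n
  · simp [taylorPowerSeries]
  · have : iteratedDeriv (n + 1) (fun z => Complex.exp z - 1) = iteratedDeriv (n + 1) Complex.exp := by
      rw [iteratedDeriv_succ', iteratedDeriv_succ']
      congr 1
      funext z
      simp
    simp [taylorPowerSeries, this, coeff_one]

/-- The entire-denominator form of `u ↦ u / (1 - exp (-u))`. -/
noncomputable def bernoulliGen (u : ℂ) : ℂ := Complex.exp u / dslope Complex.exp 0 u

theorem bernoulliGen_zero : bernoulliGen 0 = 1 := by
  simp [bernoulliGen]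

theorem bernoulliGen_mul_exp_sub_one {u : ℂ} (h : u = 0 ∨ Complex.exp u ≠ 1) :
    bernoulliGen u * (Complex.exp u - 1) = u * Complex.exp u := by
  rcases eq_or_ne u 0 with rfl | hu
  · simp
  · have h1 : Complex.exp u - 1 ≠ 0 := sub_ne_zero.mpr (h.resolve_left hu)
    rw [bernoulliGen, dslope_of_ne _ hu, slope_def_field, Complex.exp_zero, sub_zero]
    field_simp

theorem differentiableAt_bernoulliGen {u : ℂ} (h : u = 0 ∨ Complex.exp u ≠ 1) :
    DifferentiableAt ℂ bernoulliGen u := by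
  have h1 : Differentiable ℂ (dslope Complex.exp 0) := by
    rw [← differentiableOn_univ, Complex.differentiableOn_dslope Filter.univ_mem]
    exact Complex.differentiable_exp.differentiableOn
  refine Complex.differentiableAt_exp.div h1.differentiableAt ?_
  rcases eq_or_ne u 0 with rfl | hu
  · simp
  · rw [dslope_of_ne _ hu, slope_def_field, Complex.exp_zero, sub_zero]
    exact div_ne_zero (sub_ne_zero.mpr (h.resolve_left hu)) hu

theorem eq_zero_of_exp_eq_one {u : ℂ} (h : Complex.exp u = 1) (hu : |u.im| < 2 * Real.pi) :
    u = 0 := by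
  obtain ⟨n, rfl⟩ := Complex.exp_eq_one_iff.mp h
  have h1 : ((n : ℂ) * (2 * Real.pi * Complex.I)).im = n * (2 * Real.pi) := by simp
  rw [h1, abs_mul, abs_of_pos Real.two_pi_pos] at hu
  have h2 : |(n : ℝ)| < 1 := by
    by_contra! h3
    nlinarith [Real.two_pi_pos]
  have h4 : n = 0 := by
    rw [← Int.abs_lt_one_iff]
    exact_mod_cast h2
  simp [h4]

theorem eventually_nhds_zero_eq_zero_or_exp_ne_one :
    ∀ᶠ u : ℂ in nhds 0, u = 0 ∨ Complex.exp u ≠ 1 := by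
  have : {u : ℂ | |u.im| < 2 * Real.pi} ∈ nhds (0 : ℂ) :=
    (isOpen_lt (Complex.continuous_im.abs) continuous_const).mem_nhds (by simp [Real.pi_pos])
  filter_upwards [this] with u hu
  by_cases h : Complex.exp u = 1
  · exact Or.inl (eq_zero_of_exp_eq_one h hu)
  · exact Or.inr h

theorem analyticAt_bernoulliGen_zero : AnalyticAt ℂ bernoulliGen 0 :=
  Complex.analyticAt_iff_eventually_differentiableAt.mpr
    (eventually_nhds_zero_eq_zero_or_exp_ne_one.mono fun _ => differentiableAt_bernoulliGen)

theorem taylorPowerSeries_bernoulliGen :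
    taylorPowerSeries bernoulliGen = bernoulli'PowerSeries ℂ := by
  have hexp : AnalyticAt ℂ Complex.exp 0 := by fun_prop
  have h1 : (fun u => bernoulliGen u * (Complex.exp u - 1)) =ᶠ[nhds 0]
      fun u => u * Complex.exp u :=
    eventually_nhds_zero_eq_zero_or_exp_ne_one.mono fun _ => bernoulliGen_mul_exp_sub_one
  have h2 := taylorPowerSeries_congr h1
  rw [taylorPowerSeries_mul analyticAt_bernoulliGen_zero (by fun_prop),
    taylorPowerSeries_mul (f := fun z => z) analyticAt_id hexp, taylorPowerSeries_exp_sub_one,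
    taylorPowerSeries_exp] at h2
  refine mul_right_cancel₀ exp_sub_one_ne_zero ?_
  rw [h2, taylorPowerSeries_id, bernoulli'PowerSeries_mul_exp_sub_one]

theorem iteratedDeriv_bernoulliGen_pow (r n : ℕ) :
    iteratedDeriv n (fun u => bernoulliGen u ^ r) 0 / (n.factorial : ℂ) =
      coeff n (bernoulli'PowerSeries ℂ ^ r) := by
  rw [← taylorPowerSeries_bernoulliGen, ← taylorPowerSeries_pow analyticAt_bernoulliGen_zero,
    taylorPowerSeries, coeff_mk]

end TaylorPowerSeries

/-! ### λ-Bernoulli numbers as Taylor data at log λ. -/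

section LambdaBernoulli

open Complex

/-- A disc around a point of the strip `|Im L| < π` that contains the origin and no other zero of
`exp - 1`. -/
theorem exists_ball_exp_ne_one {L : ℂ} (hL : |L.im| < Real.pi) :
    ∃ R : ℝ, ‖L‖ < R ∧ ∀ u ∈ Metric.ball L R, u = 0 ∨ exp u ≠ 1 := by
  -- The radius is the distance from L to the nearer of ±2πi.
  refine ⟨√(L.re ^ 2 + (2 * Real.pi - |L.im|) ^ 2), ?_, ?_⟩
  · rw [Complex.norm_eq_sqrt_sq_add_sq]
    refine Real.sqrt_lt_sqrt (by positivity) ?_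
    nlinarith [sq_abs L.im, abs_nonneg L.im, Real.pi_pos]
  · intro u hu
    by_contra! h
    obtain ⟨h0, h1⟩ := h
    have him : 2 * Real.pi ≤ |u.im| := by
      by_contra! h2
      exact h0 (eq_zero_of_exp_eq_one h1 h2)
    have hre : u.re = 0 := by
      obtain ⟨n, rfl⟩ := Complex.exp_eq_one_iff.mp h1
      simp
    rw [Metric.mem_ball, dist_eq_norm, Complex.norm_eq_sqrt_sq_add_sq] at hu
    refine absurd hu (not_lt.mpr (Real.sqrt_le_sqrt ?_))
    have h3 : |u.im| - |L.im| ≤ |u.im - L.im| := abs_sub_abs_le_abs_sub _ _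
    have h4 : (2 * Real.pi - |L.im|) ^ 2 ≤ |u.im - L.im| ^ 2 :=
      pow_le_pow_left₀ (by linarith [Real.pi_pos]) (by linarith) 2
    rw [sq_abs] at h4
    simp only [sub_re, sub_im, hre]
    nlinarith

theorem lambdaBernoulliGen_mul_exp {lam t : ℂ} (hlam : lam ≠ 0)
    (h : log lam + t = 0 ∨ exp (log lam + t) ≠ 1) :
    lambdaBernoulliGen lam t * exp t = lam⁻¹ * bernoulliGen (log lam + t) := by
  have he : exp (log lam + t) = lam * exp t := by rw [exp_add, exp_log hlam]
  rw [lambdaBernoulliGen]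
  split_ifs with h0
  · rw [h0, bernoulliGen_zero, mul_one, one_mul]
    rw [h0, exp_zero] at he
    exact eq_inv_of_mul_eq_one_right he.symm
  · have h1 := bernoulliGen_mul_exp_sub_one h
    have h2 : lam * exp t - 1 ≠ 0 := by
      rw [← he]
      exact sub_ne_zero.mpr (h.resolve_left h0)
    rw [he] at h1
    field_simp
    linear_combination -h1

theorem lambdaBernoulli_self (r n : ℕ) {lam : ℂ} (hlam : lam ∈ slitPlane) :
    lambdaBernoulli r n lam r =
      lam⁻¹ ^ r * iteratedDeriv n (fun u => bernoulliGen u ^ r) (log lam) := by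
  have hL : |(log lam).im| < Real.pi := by
    rw [log_im, abs_lt]
    exact ⟨neg_pi_lt_arg _, lt_of_le_of_ne (arg_le_pi _) (slitPlane_arg_ne_pi hlam)⟩
  obtain ⟨R, hR, hball⟩ := exists_ball_exp_ne_one hL
  have hR0 : 0 < R := (norm_nonneg _).trans_lt hR
  have hev : (fun t : ℂ => lambdaBernoulliGen lam t ^ r * exp (r * t)) =ᶠ[nhds 0]
      fun t => lam⁻¹ ^ r * bernoulliGen (log lam + t) ^ r := by
    filter_upwards [Metric.ball_mem_nhds (0 : ℂ) hR0] with t ht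
    rw [exp_nat_mul, ← mul_pow, ← mul_pow,
      lambdaBernoulliGen_mul_exp (slitPlane_ne_zero hlam) (hball _ ?_)]
    simpa [dist_eq_norm] using ht
  rw [lambdaBernoulli, hev.iteratedDeriv_eq, iteratedDeriv_const_mul_field,
    iteratedDeriv_comp_const_add n (fun u => bernoulliGen u ^ r)]
  simp

theorem hasSum_iteratedDeriv_bernoulliGen_pow (r N : ℕ) {L : ℂ} (hL : |L.im| < Real.pi) :
    HasSum (fun j : ℕ => (j.factorial : ℂ)⁻¹ * ((-L) ^ j *
        iteratedDeriv (N + j) (fun u => bernoulliGen u ^ r) L))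
      (iteratedDeriv N (fun u => bernoulliGen u ^ r) 0) := by
  obtain ⟨R, hR, hball⟩ := exists_ball_exp_ne_one hL
  have hd : DifferentiableOn ℂ (fun u => bernoulliGen u ^ r) (Metric.ball L R) := fun u hu =>
    ((differentiableAt_bernoulliGen (hball u hu)).pow r).differentiableWithinAt
  have ha := (hd.analyticOnNhd Metric.isOpen_ball).iterated_deriv N
  rw [← iteratedDeriv_eq_iterate] at ha
  have h := Complex.hasSum_taylorSeries_on_ball (z := 0) ha.differentiableOn (by simpa using hR)
  refine (congrArg (HasSum · _) (funext fun j => ?_)).mp h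
  simp only [smul_eq_mul, zero_sub, iteratedDeriv_eq_iterate]
  rw [← Function.iterate_add_apply, add_comm j N]

theorem ringChoose_neg_sub_one (N j : ℕ) :
    ((Ring.choose (-(N : ℤ) - 1) j : ℤ) : ℂ) = (-1) ^ j * ((N + j).choose j : ℂ) := by
  rw [show -(N : ℤ) - 1 = -((N + 1 : ℕ) : ℤ) by push_cast; ring, Ring.choose_neg,
    show ((N + 1 : ℕ) : ℤ) + j - 1 = ((N + j : ℕ) : ℤ) by push_cast; ring, Ring.choose_natCast]
  simp [Int.negOnePow, Units.smul_def]

/-- The sign of the negative binomial absorbs that of (-log λ)^j, and binom(N+j, j)/(N+j)! = 1/(N!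
j!) restores the Taylor weights. -/
theorem hasSum_lambdaBernoulli (r N : ℕ) {lam : ℂ} (hlam : lam ∈ slitPlane) :
    HasSum (fun j : ℕ => ((Ring.choose (-(N : ℤ) - 1) j : ℤ) : ℂ) * log lam ^ j *
        (lambdaBernoulli r (N + j) lam r / ((N + j).factorial : ℂ)))
      (lam⁻¹ ^ r * PowerSeries.coeff N (bernoulli'PowerSeries ℂ ^ r)) := by
  have hL : |(log lam).im| < Real.pi := by
    rw [log_im, abs_lt]
    exact ⟨neg_pi_lt_arg _, lt_of_le_of_ne (arg_le_pi _) (slitPlane_arg_ne_pi hlam)⟩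
  have h := ((hasSum_iteratedDeriv_bernoulliGen_pow r N hL).div_const
    (N.factorial : ℂ)).mul_left (lam⁻¹ ^ r)
  rw [iteratedDeriv_bernoulliGen_pow] at h
  refine (congrArg (HasSum · _) (funext fun j => ?_)).mp h
  rw [ringChoose_neg_sub_one, lambdaBernoulli_self r _ hlam, neg_pow (log lam)]
  have h1 : ((N + j).factorial : ℂ) ≠ 0 := by exact_mod_cast (N + j).factorial_ne_zero
  have h2 : (N.factorial : ℂ) ≠ 0 := by exact_mod_cast N.factorial_ne_zero
  have h3 : (j.factorial : ℂ) ≠ 0 := by exact_mod_cast j.factorial_ne_zero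
  have h4 : ((N + j).choose j : ℂ) * N.factorial * j.factorial = (N + j).factorial := by
    exact_mod_cast Nat.add_choose_mul_factorial_mul_factorial N j
  generalize iteratedDeriv (N + j) (fun u => bernoulliGen u ^ r) (log lam) = D
  generalize lam⁻¹ ^ r = c
  rw [← h4] at h1 ⊢
  have h5 : ((N + j).choose j : ℂ) ≠ 0 := fun h => h1 (by rw [h]; ring)
  field_simp

end LambdaBernoulli

theorem theorem11 (r m : ℕ) (hr : 0 < r) (hm : 0 < m) :
    (∃ Z : ℂ → ℂ, IsMultipleZeta r Z) ∧
    ∀ Z : ℂ → ℂ, IsMultipleZeta r Z →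
      ∀ lam : ℂ, lam ∈ Complex.slitPlane →
        Summable (fun j : ℕ =>
          ((Ring.choose (-(m : ℤ) - (r : ℤ) - 1) j : ℤ) : ℂ) * Complex.log lam ^ j *
            (lambdaBernoulli r (m + r + j) lam (r : ℂ) / ((m + r + j).factorial : ℂ))) ∧
        Z (-(m : ℂ)) = (-lam) ^ r * (m.factorial : ℂ) *
          ∑' j : ℕ, ((Ring.choose (-(m : ℤ) - (r : ℤ) - 1) j : ℤ) : ℂ) * Complex.log lam ^ j *
            (lambdaBernoulli r (m + r + j) lam (r : ℂ) / ((m + r + j).factorial : ℂ)) := by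
  obtain ⟨k, rfl⟩ : ∃ k, r = k + 1 := ⟨r - 1, by omega⟩
  have hW := isMultipleZeta_multipleZetaSucc k
  refine ⟨⟨_, hW⟩, fun Z hZ lam hlam => ?_⟩
  have h := hasSum_lambdaBernoulli (k + 1) (m + (k + 1)) hlam
  rw [show -((m + (k + 1) : ℕ) : ℤ) - 1 = -(m : ℤ) - ((k + 1 : ℕ) : ℤ) - 1 by push_cast; ring] at h
  refine ⟨h.summable, ?_⟩
  have hl : lam ^ (k + 1) ≠ 0 := pow_ne_zero _ (Complex.slitPlane_ne_zero hlam)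
  rw [h.tsum_eq, hZ.apply_neg_eq hW, multipleZetaSucc_neg_nat, neg_pow lam, inv_pow, ← add_assoc m]
  field_simp
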